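/- All groups are finite; a class of groups is a collection of finite groups closed under isomorphism, and $\pi(G)$ is the set of primes dividing $|G|$. The Sylow graph $\Gamma_s(G)$ of a group $G$ is the directed graph with vertex set $\pi(G)$ in which $(p,q)$ is an edge if and only if $q\in\pi(N_G(P)/PC_G(P))$ for a Sylow $p$-subgroup $P$ of $G$. For a class of groups $\mathfrak{X}$ put $\Gamma_s(\mathfrak{X})=\bigcup_{G\in\mathfrak{X}}\Gamma_s(G)$ (union of vertex sets and of edge sets), $\pi(\mathfrak{X})=\bigcup_{G\in\mathfrak{X}}\pi(G)$, and let $\mathfrak{X}_{\Gamma_s}$ be the class of all groups $G$ such that $\Gamma_s(G)$ is a subgraph of $\Gamma_s(\mathfrak{X})$. A directed graph is called undirected if $(p,q)$ is an edge whenever $(q,p)$ is. Let $\mathfrak{S}$ be the class of soluble groups and, for a set $\pi$ of primes, $\mathfrak{S}_\pi$ the class of soluble groups $G$ with $\pi(G)\subseteq\pi$. A formation is a (possibly empty) class of groups $\mathfrak{F}$ that is closed under epimorphic images and such that $G\in\mathfrak{F}$ whenever $N_1,\dots,N_n$ ($n\ge 1$) are normal subgroups of $G$ with $\bigcap_i N_i=1$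 and $G/N_i\in\mathfrak{F}$ for all $i$. It is hereditary if it is closed under subgroups, and saturated if $G/\Phi(G)\in\mathfrak{F}$ implies $G\in\mathfrak{F}$, where $\Phi(G)$ is the Frattini subgroup. For a function $F$ assigning a formation $F(p)$ to every prime $p$, let $LF(F)$ be the class of all groups $G$ such that $G/C_G(H/K)\in F(p)$ for every chief factor $H/K$ of $G$ and every prime $p\in\pi(H/K)$. A class $\mathfrak{F}$ is a covering formation if $\mathfrak{F}=LF(F)$ for such a function $F$ with: $F(p)=\mathfrak{S}_{\pi(F(p))}$ and $p\in\pi(F(p))$ for all $p\in\pi(\mathfrak{F})$; $F(p)=\emptyset$ for all primes $p\notin\pi(\mathfrak{F})$; and, for all primes $p,q$, $p\in\pi(F(q))$ implies $q\in\pi(F(p))$. Theorem. Let $\mathfrak{X}$ be a class of groups such that $\Gamma_s(\mathfrak{X})$ is undirected. Then $\mathfrak{X}_{\Gamma_s}\cap\mathfrak{S}$ is a covering formation (of soluble groups). In particular, $\mathfrak{X}_{\Gamma_s}\cap\mathfrak{S}$ is a hereditary saturated formation. -/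

import Mathlib

universe u

/-- `π(α)`: the set of prime divisors of the order of a finite group, coset space, ... -/
def primesOf (α : Type*) : Set ℕ := {p | p ∈ (Nat.card α).primeFactors}

/-- A directed graph: a set of vertices (here natural numbers) and a set of ordered pairs of
vertices, the edges. -/
structure PrimeGraph where
  /-- the vertices -/
  V : Set ℕ
  /-- the edges -/
  E : Set (ℕ × ℕ)
  left_mem : ∀ e ∈ E, e.1 ∈ V
  right_mem : ∀ e ∈ E, e.2 ∈ V

namespace PrimeGraph

/-- `Γ` is a subgraph of `Δ`. -/
def IsSubgraph (Γ Δ : PrimeGraph) : Prop := Γ.V ⊆ Δ.V ∧ Γ.E ⊆ Δ.E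

/-- `Γ` is undirected. -/
def IsUndirected (Γ : PrimeGraph) : Prop := ∀ p q : ℕ, (p, q) ∈ Γ.E ↔ (q, p) ∈ Γ.E

end PrimeGraph

/-- The subgroup `P C_G(P)` (normal in `N_G(P)`). -/
def mulCentralizer {G : Type*} [Group G] (P : Subgroup G) : Subgroup G :=
  P ⊔ Subgroup.centralizer (P : Set G)

/-- The set of cosets of `P C_G(P)` in `N_G(P)`, i.e. the underlying set of
`N_G(P) / P C_G(P)`. -/
abbrev OuterAutomizer {G : Type*} [Group G] (P : Subgroup G) : Type _ :=
  Subgroup.normalizer (P : Set G) ⧸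
    (mulCentralizer P).subgroupOf (Subgroup.normalizer (P : Set G))

theorem primesOf_subset_of_dvd {α β : Type*} [Finite β] [Nonempty β]
    (h : Nat.card α ∣ Nat.card β) : primesOf α ⊆ primesOf β := fun _ hp =>
  Nat.primeFactors_mono h Nat.card_pos.ne' hp

theorem primesOf_congr {α β : Type*} (e : α ≃ β) : primesOf α = primesOf β := by
  simp only [primesOf, Nat.card_congr e]

/-- The Sylow graph `Γ_s(G)` of a finite group `G`: the vertices are the primes dividing `|G|`, and
`(p, q)` is an edge iff `q ∈ π(N_G(P) / P C_G(P))` for a Sylow `p`-subgroup `P` of `G`. -/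
def sylowGraph (G : Type*) [Group G] [Finite G] : PrimeGraph where
  V := primesOf G
  E := {e | e.1 ∈ primesOf G ∧
    ∃ P : Sylow e.1 G, e.2 ∈ primesOf (OuterAutomizer (P : Subgroup G))}
  left_mem _ h := h.1
  right_mem := by
    rintro e ⟨-, P, h⟩
    exact primesOf_subset_of_dvd
      ((Subgroup.card_quotient_dvd_card _).trans (Subgroup.card_subgroup_dvd_card _)) h

theorem map_centralizer_equiv {G H : Type*} [Group G] [Group H] (e : G ≃* H)
    (P : Subgroup G) :
    (Subgroup.centralizer (P : Set G)).map e.toMonoidHom =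
      Subgroup.centralizer ((P.map e.toMonoidHom : Subgroup H) : Set H) := by
  ext x
  obtain ⟨x, rfl⟩ := e.surjective x
  simp [Subgroup.mem_centralizer_iff, ← map_mul]

theorem card_outerAutomizer_map {G H : Type*} [Group G] [Group H] (e : G ≃* H)
    (P : Subgroup G) :
    Nat.card (OuterAutomizer (P.map e.toMonoidHom)) = Nat.card (OuterAutomizer P) := by
  have h := Subgroup.relIndex_map_map_of_injective (f := e.toMonoidHom) (mulCentralizer P)
    (Subgroup.normalizer (P : Set G)) e.injective
  have h1 : (Subgroup.normalizer (P : Set G)).map e.toMonoidHom =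
      Subgroup.normalizer ((P.map e.toMonoidHom : Subgroup H) : Set H) :=
    Subgroup.map_equiv_normalizer_eq P e
  have h2 : (mulCentralizer P).map e.toMonoidHom = mulCentralizer (P.map e.toMonoidHom) := by
    simp only [mulCentralizer, Subgroup.map_sup, map_centralizer_equiv]
  rw [h1, h2] at h
  exact h

/-- Isomorphic groups have the same Sylow graph (one inclusion). -/
theorem sylowGraph_isSubgraph_of_equiv {G H : Type*} [Group G] [Group H] [Finite G] [Finite H]
    (e : G ≃* H) : (sylowGraph H).IsSubgraph (sylowGraph G) := by
  have hV : primesOf H = primesOf G := primesOf_congr e.symm.toEquiv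
  refine ⟨hV.le, ?_⟩
  rintro ⟨p, q⟩ ⟨hp, P, hq⟩
  refine ⟨hV ▸ hp, P.comapOfInjective e.toMonoidHom e.injective (fun x _ => ?_), ?_⟩
  · obtain ⟨y, hy⟩ := e.surjective x
    exact ⟨y, hy⟩
  · have h := card_outerAutomizer_map e ((P : Subgroup H).comap e.toMonoidHom)
    rw [Subgroup.map_comap_eq_self_of_surjective e.surjective] at h
    have hq' : q ∈ (Nat.card (OuterAutomizer (P : Subgroup H))).primeFactors := hq
    rw [h] at hq'
    exact hq'

/-- A class of groups: a collection of finite groups closed under isomorphism. -/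
structure GroupClass where
  /-- membership in the class -/
  Mem : ∀ (G : Type u) [Group G], Prop
  finite : ∀ (G : Type u) [Group G], Mem G → Finite G
  iso : ∀ (G H : Type u) [Group G] [Group H], (G ≃* H) → Mem G → Mem H

namespace GroupClass

/-- The empty class. -/
def empty : GroupClass.{u} where
  Mem _ _ := False
  finite _ _ h := h.elim
  iso _ _ _ _ _ h := h

/-- `𝔖`: the class of finite soluble groups. -/
def soluble : GroupClass.{u} where
  Mem G _ := Finite G ∧ Group.IsSolvable G
  finite _ _ h := h.1
  iso _ _ _ _ e h := by
    obtain ⟨_, _⟩ := h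
    exact ⟨Finite.of_equiv _ e.toEquiv, Group.isSolvable_of_surjective (f := e.toMonoidHom) e.surjective⟩

/-- `𝔖_π`: the class of finite soluble `π`-groups. -/
def solublePi (π : Set ℕ) : GroupClass.{u} where
  Mem G _ := soluble.Mem G ∧ primesOf G ⊆ π
  finite _ _ h := soluble.finite _ h.1
  iso _ _ _ _ e h := ⟨soluble.iso _ _ e h.1, primesOf_congr e.symm.toEquiv ▸ h.2⟩

/-- The intersection of two classes. -/
def inter (𝔛 𝔜 : GroupClass.{u}) : GroupClass.{u} where
  Mem G _ := 𝔛.Mem G ∧ 𝔜.Mem G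
  finite _ _ h := 𝔛.finite _ h.1
  iso _ _ _ _ e h := ⟨𝔛.iso _ _ e h.1, 𝔜.iso _ _ e h.2⟩

/-- `π(𝔛)`: the union of the sets `π(G)` for `G` in `𝔛`. -/
def primes (𝔛 : GroupClass.{u}) : Set ℕ :=
  {p | ∃ (G : Type u) (_ : Group G), 𝔛.Mem G ∧ p ∈ primesOf G}

/-- `Γ_s(𝔛)`: the union of the Sylow graphs of the groups in `𝔛`. -/
def sylowGraph (𝔛 : GroupClass.{u}) : PrimeGraph where
  V := {p | ∃ (G : Type u) (_ : Group G) (_ : Finite G), 𝔛.Mem G ∧ p ∈ (_root_.sylowGraph G).V}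
  E := {e | ∃ (G : Type u) (_ : Group G) (_ : Finite G), 𝔛.Mem G ∧ e ∈ (_root_.sylowGraph G).E}
  left_mem := by
    rintro e ⟨G, _, _, hG, he⟩
    exact ⟨G, _, _, hG, (_root_.sylowGraph G).left_mem e he⟩
  right_mem := by
    rintro e ⟨G, _, _, hG, he⟩
    exact ⟨G, _, _, hG, (_root_.sylowGraph G).right_mem e he⟩

/-- `𝔛_{Γ_s}`: the class of all finite groups `G` such that `Γ_s(G)` is a subgraph of `Γ_s(𝔛)`. -/
def sylowClosure (𝔛 : GroupClass.{u}) : GroupClass.{u} where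
  Mem G _ := ∃ _ : Finite G, (_root_.sylowGraph G).IsSubgraph 𝔛.sylowGraph
  finite _ _ h := h.1
  iso _ _ _ _ e h := by
    obtain ⟨_, h⟩ := h
    have hfin := Finite.of_equiv _ e.toEquiv
    have h' := sylowGraph_isSubgraph_of_equiv e
    exact ⟨hfin, h'.1.trans h.1, h'.2.trans h.2⟩

/-- Closure under epimorphic images. -/
def IsQClosed (𝔛 : GroupClass.{u}) : Prop :=
  ∀ (G H : Type u) [Group G] [Group H] (f : G →* H), Function.Surjective f → 𝔛.Mem G → 𝔛.Mem H

/-- Closure under finite subdirect products: if `N₁, …, Nₙ` (`n ≥ 1`) are normal subgroups of the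
finite group `G` with trivial intersection and every `G ⧸ Nᵢ` is in `𝔛`, then so is `G`. -/
def IsR0Closed (𝔛 : GroupClass.{u}) : Prop :=
  ∀ (G : Type u) [Group G] [Finite G] (n : ℕ) (N : Fin (n + 1) → Subgroup G)
    [∀ i, (N i).Normal], (∀ i, 𝔛.Mem (G ⧸ N i)) → ⨅ i, N i = ⊥ → 𝔛.Mem G

/-- A formation: a (possibly empty) class closed under epimorphic images and finite subdirect
products. -/
def IsFormation (𝔛 : GroupClass.{u}) : Prop := 𝔛.IsQClosed ∧ 𝔛.IsR0Closed

/-- Closure under subgroups. -/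
def IsHereditary (𝔛 : GroupClass.{u}) : Prop :=
  ∀ (G : Type u) [Group G] (H : Subgroup G), 𝔛.Mem G → 𝔛.Mem H

/-- Closure under Frattini extensions. -/
def IsSaturated (𝔛 : GroupClass.{u}) : Prop :=
  ∀ (G : Type u) [Group G] [Finite G], 𝔛.Mem (G ⧸ frattini G) → 𝔛.Mem G

end GroupClass

/-- `H / K` is a chief factor of `G`: `K < H` are normal in `G` and no normal subgroup of `G` lies
strictly between them. -/
structure IsChiefFactor {G : Type*} [Group G] (H K : Subgroup G) : Prop where
  normal_top : H.Normal
  normal_bot : K.Normal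
  lt : K < H
  minimal : ∀ N : Subgroup G, N.Normal → K ≤ N → N ≤ H → N = K ∨ N = H

/-- `C_G(H / K)`: the elements of `G` that centralize `H / K`, i.e. the preimage in `G` of the
centralizer of the image of `H` in `G ⧸ K`. -/
def factorCentralizer {G : Type*} [Group G] (H K : Subgroup G) [K.Normal] : Subgroup G :=
  (Subgroup.centralizer
    ((H.map (QuotientGroup.mk' K) : Subgroup (G ⧸ K)) : Set (G ⧸ K))).comap (QuotientGroup.mk' K)

instance factorCentralizer_normal {G : Type*} [Group G] (H K : Subgroup G) [H.Normal] [K.Normal] :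
    (factorCentralizer H K).Normal := by
  have : (H.map (QuotientGroup.mk' K)).Normal :=
    Subgroup.Normal.map ‹H.Normal› _ (QuotientGroup.mk'_surjective K)
  unfold factorCentralizer
  infer_instance

theorem mem_factorCentralizer_iff {G : Type*} [Group G] (H K : Subgroup G) [K.Normal] (g : G) :
    g ∈ factorCentralizer H K ↔ ∀ h ∈ H, (h * g)⁻¹ * (g * h) ∈ K := by
  simp only [factorCentralizer, Subgroup.mem_comap, Subgroup.mem_centralizer_iff,
    Subgroup.coe_map, Set.forall_mem_image, SetLike.mem_coe, QuotientGroup.mk'_apply,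
    ← QuotientGroup.mk_mul, QuotientGroup.eq]

theorem factorCentralizer_comap {G G' : Type*} [Group G] [Group G'] (e : G ≃* G')
    (H K : Subgroup G') [K.Normal] :
    (factorCentralizer (H.comap e.toMonoidHom) (K.comap e.toMonoidHom)).map (e : G →* G') =
      factorCentralizer H K := by
  ext x
  obtain ⟨x, rfl⟩ := e.surjective x
  have h1 : e x ∈ (factorCentralizer (H.comap e.toMonoidHom) (K.comap e.toMonoidHom)).map
      (e : G →* G') ↔ x ∈ factorCentralizer (H.comap e.toMonoidHom) (K.comap e.toMonoidHom) := by
    simp [Subgroup.mem_map]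
  rw [h1, mem_factorCentralizer_iff, mem_factorCentralizer_iff, e.surjective.forall]
  simp

theorem IsChiefFactor.comap {G G' : Type*} [Group G] [Group G'] (e : G ≃* G')
    {H K : Subgroup G'} (h : IsChiefFactor H K) :
    IsChiefFactor (H.comap e.toMonoidHom) (K.comap e.toMonoidHom) where
  normal_top := h.normal_top.comap _
  normal_bot := h.normal_bot.comap _
  lt := (Subgroup.comap_lt_comap_of_surjective e.surjective).2 h.lt
  minimal N hN hKN hNH := by
    have hmap : (N.map e.toMonoidHom).comap e.toMonoidHom = N :=
      Subgroup.comap_map_eq_self_of_injective e.injective N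
    have h1 := h.minimal (N.map e.toMonoidHom) (hN.map _ e.surjective)
      ((Subgroup.comap_le_comap_of_surjective e.surjective).1 (by rwa [hmap]))
      (Subgroup.map_le_iff_le_comap.2 hNH)
    rw [← hmap]
    exact h1.imp (fun h => by rw [h]) (fun h => by rw [h])

namespace GroupClass

/-- `LF(f)`: the class of all finite groups `G` such that `G / C_G(H / K) ∈ f(p)` for every chief
factor `H / K` of `G` and every prime `p ∈ π(H / K)`. -/
def localFormation (f : ℕ → GroupClass.{u}) : GroupClass.{u} where
  Mem G _ := Finite G ∧ ∀ (H K : Subgroup G) [H.Normal] [K.Normal], IsChiefFactor H K →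
    ∀ p ∈ primesOf (H ⧸ K.subgroupOf H), (f p).Mem (G ⧸ factorCentralizer H K)
  finite _ _ h := h.1
  iso G G' _ _ e h := by
    obtain ⟨hfin, h⟩ := h
    refine ⟨Finite.of_equiv _ e.toEquiv, fun H K _ _ hHK p hp => ?_⟩
    have hcard : K.relIndex H = (K.comap e.toMonoidHom).relIndex (H.comap e.toMonoidHom) := by
      rw [Subgroup.relIndex_comap, Subgroup.map_comap_eq_self_of_surjective e.surjective]
    have hp' : p ∈ primesOf (H.comap e.toMonoidHom ⧸
        (K.comap e.toMonoidHom).subgroupOf (H.comap e.toMonoidHom)) := by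
      have h2 : p ∈ (K.relIndex H).primeFactors := hp
      rw [hcard] at h2
      exact h2
    exact (f p).iso _ _ (QuotientGroup.congr _ _ e (factorCentralizer_comap e H K))
      (h _ _ (hHK.comap e) p hp')

/-- A covering formation: a local formation `𝔉 = LF(F)`, for a formation function `F` such that
`F(p) = 𝔖_{π(F(p))}` and `p ∈ π(F(p))` for `p ∈ π(𝔉)`, `F(p) = ∅` for the other primes `p`, and
`p ∈ π(F(q))` implies `q ∈ π(F(p))`. Only the values of `F` at primes matter. -/
def IsCoveringFormation (𝔉 : GroupClass.{u}) : Prop :=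
  ∃ F : ℕ → GroupClass.{u},
    (∀ p, p.Prime → (F p).IsFormation) ∧
    𝔉 = localFormation F ∧
    (∀ p ∈ 𝔉.primes, F p = solublePi (F p).primes ∧ p ∈ (F p).primes) ∧
    (∀ p, p.Prime → p ∉ 𝔉.primes → F p = empty) ∧
    (∀ p q, p.Prime → q.Prime → p ∈ (F q).primes → q ∈ (F p).primes)

end GroupClass

/-! For a soluble group G and primes p ≠ q, three conditions are equivalent: neither (p, q) nor (q,
p) is an edge of Γ_s(G); some Sylow p-subgroup and some Sylow q-subgroup commute elementwise; q does
not divide |G / C_G(H/K)| for any chief factor H/K of order divisible by p, and the same holds with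
p and q exchanged. Undirectedness of Γ_s(𝔛) makes non-edges come in such pairs, so membership in the
class is a condition on chief factors: it is LF(F) with F(p) the soluble groups over p and its
neighbours.

Missing edges yield commuting Sylow subgroups by induction modulo a normal r-subgroup
(`sylowCommute_of_not_sylowEdge`). Commuting passes to chief factors because a normal p-subgroup
lies in every Sylow p-subgroup (`SylowCommute.not_dvd_index_factorCentralizer`). Conversely, a
q-element acting trivially on those chief factors and normalizing a p-subgroup centralizes it, by
coprime action along a chief series (`mem_centralizer_of_not_dvd_index_factorCentralizer`); since
any p-subgroup is allowed, this also gives heredity.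

Saturation is proved directly: commuting modulo a normal subgroup of Φ(G) lifts to G
(`SylowCommute.bot_of_le_frattini`). The hard case, a p-group inside Φ(G), is
`le_centralizer_of_le_frattini`. -/

open Subgroup
open scoped Pointwise commutatorElement

/-! ### Coprime orders and Frattini arguments -/

section Basic

variable {G : Type*} [Group G]

theorem Subgroup.mem_of_pow_mem_of_coprime {H : Subgroup G} {x : G} {a b : ℕ}
    (hab : a.Coprime b) (ha : x ^ a ∈ H) (hb : x ^ b ∈ H) : x ∈ H := by
  have h : x = (x ^ a) ^ (a.gcdA b) * (x ^ b) ^ (a.gcdB b) := by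
    rw [← zpow_natCast, ← zpow_natCast, ← zpow_mul, ← zpow_mul, ← zpow_add,
      ← Nat.gcd_eq_gcd_ab, hab.gcd_eq_one, Nat.cast_one, zpow_one]
  rw [h]
  exact H.mul_mem (H.zpow_mem ha _) (H.zpow_mem hb _)

theorem Subgroup.mem_of_pow_eq_one_of_not_dvd_index [Finite G] {H : Subgroup G} [H.Normal]
    {q k : ℕ} (hq : q.Prime) (h : ¬ q ∣ H.index) {x : G} (hx : x ^ q ^ k = 1) : x ∈ H :=
  H.mem_of_pow_mem_of_coprime (((Nat.Prime.coprime_iff_not_dvd hq).2 h).pow_left k)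
    (hx ▸ H.one_mem) (H.pow_index_mem x)

/-- If `x` has order dividing `a` and conjugates `y` to `y z`, where `z` commutes with `x` and has
order coprime to `a`, then `z = 1`. -/
theorem commute_of_conj_eq_mul {x y z : G} {a b : ℕ} (hab : a.Coprime b) (hx : x ^ a = 1)
    (hz : z ^ b = 1) (hxz : Commute x z) (h : x * y * x⁻¹ = y * z) : Commute x y := by
  -- Conjugation by `x` fixes `z`, so iterating it multiplies `y` by powers of `z`; at `n = a` this
  -- gives `z ^ a = 1`.
  have key : ∀ n : ℕ, x ^ n * y * (x ^ n)⁻¹ = y * z ^ n := by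
    intro n
    induction n with
    | zero => simp
    | succ n ih =>
      calc x ^ (n + 1) * y * (x ^ (n + 1))⁻¹ = x * (x ^ n * y * (x ^ n)⁻¹) * x⁻¹ := by
            rw [pow_succ']; group
        _ = (x * y * x⁻¹) * (x * z ^ n * x⁻¹) := by rw [ih]; group
        _ = y * z ^ (n + 1) := by
            rw [h, (hxz.pow_right n).eq, mul_inv_cancel_right, pow_succ', mul_assoc]
  have h1 : z ^ a = 1 := by simpa [hx] using key a
  have h2 : z = 1 := by
    have := (⊥ : Subgroup G).mem_of_pow_mem_of_coprime hab (x := z) (by simp [h1]) (by simp [hz])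
    simpa using this
  rw [h2, mul_one] at h
  exact mul_inv_eq_iff_eq_mul.1 h

theorem IsPGroup.coprime_card [Finite G] {p q : ℕ} [Fact p.Prime] [Fact q.Prime] (hpq : p ≠ q)
    {N : Subgroup G} (hN : IsPGroup p N) : (Nat.card N).Coprime q := by
  obtain ⟨k, hk⟩ := IsPGroup.iff_card.1 hN
  rw [hk]
  exact ((Nat.coprime_primes Fact.out Fact.out).2 hpq).pow_left k

theorem IsPGroup.exists_pow_eq_one {p : ℕ} {N : Subgroup G} (hN : IsPGroup p N) {x : G}
    (hx : x ∈ N) : ∃ k, x ^ p ^ k = 1 := by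
  obtain ⟨k, hk⟩ := hN ⟨x, hx⟩
  exact ⟨k, by simpa [Subtype.ext_iff] using hk⟩

/-- The Frattini argument relative to a normal subgroup `N`: the normalizer of `P N` is
`N_G(P) N`. -/
theorem Sylow.normalizer_sup_le [Finite G] {p : ℕ} [Fact p.Prime] (P : Sylow p G) (N : Subgroup G)
    [N.Normal] : normalizer (((P : Subgroup G) ⊔ N : Subgroup G) : Set G) ≤
      normalizer ((P : Subgroup G) : Set G) ⊔ N := by
  intro g hg
  have h1 : ((g • P : Sylow p G) : Subgroup G) ≤ (P : Subgroup G) ⊔ N := by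
    intro x hx
    rw [Sylow.coe_subgroup_smul, Subgroup.mem_smul_pointwise_iff_exists] at hx
    obtain ⟨y, hy, rfl⟩ := hx
    exact (Subgroup.mem_normalizer_iff.1 hg y).1 ((le_sup_left : (P : Subgroup G) ≤ _) hy)
  -- `P` and its conjugate by `g` are both Sylow in `P N`, hence conjugate there.
  obtain ⟨t, ht⟩ := MulAction.exists_smul_eq ((P : Subgroup G) ⊔ N : Subgroup G)
    ((g • P).subtype h1) (P.subtype le_sup_left)
  rw [Sylow.smul_subtype] at ht
  have h2 := Sylow.subtype_injective ht
  have h3 : (t : G) * g ∈ normalizer ((P : Subgroup G) : Set G) := by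
    refine Sylow.smul_eq_iff_mem_normalizer.1 ?_
    rw [mul_smul]
    exact h2
  have h4 : (t : G) ∈ normalizer ((P : Subgroup G) : Set G) ⊔ N :=
    (sup_le_sup_right le_normalizer N) t.2
  have := mul_mem (inv_mem h4) ((le_sup_left : _ ≤ normalizer ((P : Subgroup G) : Set G) ⊔ N) h3)
  simpa using this

theorem Sylow.exists_le_of_not_dvd_index [Finite G] {q : ℕ} [Fact q.Prime] {H : Subgroup G}
    (h : ¬ q ∣ H.index) : ∃ Q : Sylow q G, (Q : Subgroup G) ≤ H := by
  obtain ⟨R⟩ := Sylow.nonempty (p := q) (G := H)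
  refine ⟨(R.isPGroup'.map H.subtype).toSylow ?_, H.map_subtype_le _⟩
  rw [Subgroup.index_map_subtype]
  exact Nat.Prime.not_dvd_mul Fact.out R.not_dvd_index h

/-- The index |HN : H| equals |N : N ∩ H|. -/
theorem Subgroup.relIndex_sup_dvd_card [Finite G] (H N : Subgroup G) [N.Normal] :
    H.relIndex (H ⊔ N) ∣ Nat.card N := by
  have h1 : Nat.card H * H.relIndex (H ⊔ N) = Nat.card (H ⊔ N : Subgroup G) := by
    rw [← relIndex_bot_left, ← relIndex_bot_left, relIndex_mul_relIndex _ _ _ bot_le le_sup_left]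
  have h2 : Nat.card N * N.relIndex H = Nat.card (H ⊔ N : Subgroup G) := by
    rw [← relIndex_sup_right H N, ← relIndex_bot_left, ← relIndex_bot_left,
      relIndex_mul_relIndex _ _ _ bot_le le_sup_right]
  have h3 : Nat.card (N ⊓ H : Subgroup G) * N.relIndex H = Nat.card H := by
    rw [← inf_relIndex_right N H, ← relIndex_bot_left, ← relIndex_bot_left,
      relIndex_mul_relIndex _ _ _ bot_le inf_le_right]
  refine ⟨Nat.card (N ⊓ H : Subgroup G), Nat.eq_of_mul_eq_mul_right
    (Nat.pos_of_ne_zero (index_ne_zero_of_finite (H := N.subgroupOf H))) ?_⟩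
  change Nat.card N * N.relIndex H = _ * N.relIndex H
  rw [h2, ← h1, ← h3]
  ring

theorem Group.isNilpotent_of_isMulCommutative (A : Type*) [Group A] [IsMulCommutative A] :
    Group.IsNilpotent A :=
  letI : CommGroup A := { ‹Group A› with mul_comm := mul_comm' }
  inferInstance

end Basic

/-! ### Characteristic subgroups of soluble groups -/

section Solvable

variable {G : Type*} [Group G] [Finite G]

/-- The last nontrivial term of the derived series works. -/
theorem exists_characteristic_commutative_ne_bot (G : Type*) [Group G] [Nontrivial G]
    [Group.IsSolvable G] :
    ∃ A : Subgroup G, A.Characteristic ∧ IsMulCommutative A ∧ A ≠ ⊥ := by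
  classical
  have hex : ∃ n, derivedSeries G n = ⊥ := Group.IsSolvable.solvable
  have h0 : Nat.find hex ≠ 0 := by
    intro h
    have := Nat.find_spec hex
    rw [h, derivedSeries_zero] at this
    exact top_ne_bot this
  obtain ⟨n, hn⟩ := Nat.exists_eq_succ_of_ne_zero h0
  refine ⟨derivedSeries G n, inferInstance, ?_, Nat.find_min hex (by omega)⟩
  rw [← commutator_self_eq_bot_iff]
  have := Nat.find_spec hex
  rwa [hn, derivedSeries_succ] at this

/-- The image of a Sylow subgroup of a nilpotent characteristic subgroup is characteristic. -/
theorem Sylow.characteristic_map_subtype {W : Subgroup G} [W.Characteristic] [Group.IsNilpotent W]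
    {r : ℕ} [Fact r.Prime] (S : Sylow r W) :
    ((S : Subgroup W).map W.subtype).Characteristic := by
  have h1 : (S : Subgroup W).Normal :=
    (Group.isNilpotent_of_finite_tfae.out 0 3 rfl rfl).1 ‹_› r ‹_› S
  have h2 := S.characteristic_of_normal h1
  infer_instance

/-- A Sylow subgroup of a nontrivial abelian characteristic subgroup works. It serves as the
subgroup to divide out in inductions on the order. -/
theorem exists_characteristic_isPGroup_ne_bot (G : Type*) [Group G] [Finite G] [Nontrivial G]
    [Group.IsSolvable G] :
    ∃ (r : ℕ) (_ : Fact r.Prime) (R : Subgroup G), R.Characteristic ∧ IsPGroup r R ∧ R ≠ ⊥ := by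
  obtain ⟨A, hA, hA', hne⟩ := exists_characteristic_commutative_ne_bot G
  have hcard : Nat.card A ≠ 1 := fun h => hne (Subgroup.card_eq_one.1 h)
  obtain ⟨r, hr, hrA⟩ := Nat.exists_prime_and_dvd hcard
  have : Fact r.Prime := ⟨hr⟩
  obtain ⟨S⟩ := Sylow.nonempty (p := r) (G := A)
  have hnil : Group.IsNilpotent A := Group.isNilpotent_of_isMulCommutative A
  refine ⟨r, this, _, S.characteristic_map_subtype, S.isPGroup'.map _, ?_⟩
  rw [Ne, Subgroup.map_eq_bot_iff_of_injective _ A.subtype_injective]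
  exact S.ne_bot_of_dvd_card hrA

theorem isPGroup_of_forall_sylow_eq_bot {p : ℕ} [Fact p.Prime]
    (h : ∀ r : ℕ, r.Prime → r ≠ p → ∀ S : Sylow r G, (S : Subgroup G) = ⊥) : IsPGroup p G := by
  refine IsPGroup.of_card (Nat.eq_prime_pow_of_unique_prime_dvd Nat.card_pos.ne' fun {r} hr hd => ?_)
  by_contra hne
  have : Fact r.Prime := ⟨hr⟩
  obtain ⟨S⟩ := Sylow.nonempty (p := r) (G := G)
  exact S.ne_bot_of_dvd_card hd (h r hr hne S)

/-- A finite soluble group all of whose characteristic `p`-subgroups are central and which has no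
nontrivial characteristic `r`-subgroup for primes `r ≠ p` is a `p`-group. -/
theorem isPGroup_of_characteristic_isPGroup_central {p : ℕ} [Fact p.Prime] [Group.IsSolvable G]
    (h1 : ∀ R : Subgroup G, R.Characteristic → IsPGroup p R → R ≤ center G)
    (h2 : ∀ r : ℕ, r.Prime → r ≠ p → ∀ R : Subgroup G, R.Characteristic → IsPGroup r R → R = ⊥) :
    IsPGroup p G := by
  have key : ∀ W : Subgroup G, W.Characteristic → Group.IsNilpotent W → IsPGroup p W := by
    intro W _ _
    refine isPGroup_of_forall_sylow_eq_bot fun r hr hrp S => ?_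
    have : Fact r.Prime := ⟨hr⟩
    have := h2 r hr hrp _ S.characteristic_map_subtype (S.isPGroup'.map _)
    exact (Subgroup.map_eq_bot_iff_of_injective _ W.subtype_injective).1 this
  rcases subsingleton_or_nontrivial (G ⧸ center G) with hs | hn
  · have hc : center G = ⊤ := QuotientGroup.subgroup_eq_top_of_subsingleton _ hs
    have : IsPGroup p (⊤ : Subgroup G) := by
      rw [← hc]
      exact key _ inferInstance (Group.isNilpotent_of_isMulCommutative _)
    exact this.of_equiv Subgroup.topEquiv
  -- The preimage of `A` is a central extension of an abelian group, so it is nilpotent, a p-group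
  -- by `key`, and central by `h1`. This contradicts `A ≠ ⊥`.
  · obtain ⟨A, hA, hA', hne⟩ := exists_characteristic_commutative_ne_bot (G ⧸ center G)
    exfalso
    have hW : (A.comap (QuotientGroup.mk' (center G))).Characteristic :=
      Subgroup.Characteristic.comap_quotient_mk hA
    have hnil : Group.IsNilpotent (A.comap (QuotientGroup.mk' (center G))) := by
      have hAn : Group.IsNilpotent A := Group.isNilpotent_of_isMulCommutative A
      refine Subgroup.isNilpotent_of_ker_le_center
        ((QuotientGroup.mk' (center G)).subgroupComap A) ?_
      intro x hx
      have hx' : (x : G) ∈ center G :=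
        (QuotientGroup.eq_one_iff (x : G)).1 (congrArg Subtype.val hx)
      rw [Subgroup.mem_center_iff] at hx' ⊢
      intro y
      exact Subtype.ext (hx' y)
    have hle := h1 _ hW (key _ hW hnil)
    apply hne
    have := Subgroup.map_mono (f := QuotientGroup.mk' (center G)) hle
    rwa [Subgroup.map_comap_eq_self_of_surjective (QuotientGroup.mk'_surjective _),
      QuotientGroup.map_mk'_self, le_bot_iff] at this

end Solvable

/-! ### Centralizers modulo a normal subgroup -/

section FactorCentralizer

variable {G : Type*} [Group G]

theorem mem_factorCentralizer_iff_commutator {H K : Subgroup G} [K.Normal] {g : G} :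
    g ∈ factorCentralizer H K ↔ ∀ h ∈ H, ⁅h, g⁆ ∈ K := by
  rw [mem_factorCentralizer_iff]
  refine forall₂_congr fun h _ => ?_
  rw [(inferInstance : K.Normal).mem_comm_iff, ← inv_mem_iff]
  simp [commutatorElement_def, mul_assoc]

theorem le_factorCentralizer_iff {H K L : Subgroup G} [K.Normal] :
    L ≤ factorCentralizer H K ↔ ⁅H, L⁆ ≤ K := by
  rw [Subgroup.commutator_le]
  exact ⟨fun h a ha b hb => mem_factorCentralizer_iff_commutator.1 (h hb) a ha,
    fun h b hb => mem_factorCentralizer_iff_commutator.2 fun a ha => h a ha b hb⟩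

end FactorCentralizer

/-- Some Sylow `p`-subgroup and some Sylow `q`-subgroup of `G` commute modulo `N`. -/
def SylowCommute (G : Type*) [Group G] (p q : ℕ) (N : Subgroup G) : Prop :=
  ∃ (P : Sylow p G) (Q : Sylow q G), ⁅(P : Subgroup G), (Q : Subgroup G)⁆ ≤ N

/-- `q` divides the order of `N_G(P) / P C_G(P)` for some Sylow `p`-subgroup `P` of `G`. -/
def SylowEdge (G : Type*) [Group G] (p q : ℕ) : Prop :=
  ∃ P : Sylow p G, q ∣ (mulCentralizer (P : Subgroup G)).relIndex
    (normalizer ((P : Subgroup G) : Set G))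

/-! ### Commuting Sylow subgroups -/

section SylowCommute

variable {G : Type*} [Group G] {p q : ℕ} {N : Subgroup G}

theorem SylowCommute.symm (h : SylowCommute G p q N) : SylowCommute G q p N := by
  obtain ⟨P, Q, h⟩ := h
  exact ⟨Q, P, Subgroup.commutator_comm (P : Subgroup G) Q ▸ h⟩

variable [Finite G] [hp : Fact p.Prime] [hq : Fact q.Prime]

theorem SylowCommute.map {H : Type*} [Group H] {f : G →* H} (hf : Function.Surjective f)
    (h : SylowCommute G p q N) : SylowCommute H p q (N.map f) := by
  obtain ⟨P, Q, h⟩ := h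
  refine ⟨P.mapSurjective hf, Q.mapSurjective hf, ?_⟩
  rw [Sylow.coe_mapSurjective, Sylow.coe_mapSurjective, ← map_commutator]
  exact Subgroup.map_mono h

theorem SylowCommute.comap {H : Type*} [Group H] {f : G →* H} (hf : Function.Surjective f)
    {M : Subgroup H} (h : SylowCommute H p q M) : SylowCommute G p q (M.comap f) := by
  obtain ⟨P, Q, h⟩ := h
  obtain ⟨P, rfl⟩ := Sylow.mapSurjective_surjective hf p P
  obtain ⟨Q, rfl⟩ := Sylow.mapSurjective_surjective hf q Q
  refine ⟨P, Q, ?_⟩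
  rwa [Sylow.coe_mapSurjective, Sylow.coe_mapSurjective, ← map_commutator,
    Subgroup.map_le_iff_le_comap] at h

theorem SylowCommute.of_quotient [N.Normal] (h : SylowCommute (G ⧸ N) p q ⊥) :
    SylowCommute G p q N := by
  have := h.comap (QuotientGroup.mk'_surjective N)
  rwa [MonoidHom.comap_bot, QuotientGroup.ker_mk'] at this

/-- Sylow subgroups commuting modulo a normal subgroup of order prime to `p` and `q` can be
replaced by commuting ones. -/
theorem SylowCommute.bot_of_coprime [N.Normal] (hNp : (Nat.card N).Coprime p)
    (hNq : (Nat.card N).Coprime q) (h : SylowCommute G p q N) : SylowCommute G p q ⊥ := by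
  obtain ⟨P, Q, h⟩ := h
  -- Here `N` need not lie in `P`: `C` is the group of elements commuting with `P` modulo `N`.
  set C := factorCentralizer (P : Subgroup G) N with hC
  set X := normalizer ((P : Subgroup G) : Set G) with hX
  have hPC : ⁅(P : Subgroup G), C⁆ ≤ N := le_factorCentralizer_iff.1 le_rfl
  have hQC : (Q : Subgroup G) ≤ C := le_factorCentralizer_iff.2 h
  have hNC : N ≤ C := le_factorCentralizer_iff.2 (commutator_le_right _ _)
  -- `C` normalizes `P N`, so the Frattini argument applies; Dedekind's law then gives C = (C ∩ X)
  -- N.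
  have hCX : C ≤ X ⊔ N := by
    refine le_trans ?_ (P.normalizer_sup_le N)
    rw [le_normalizer_iff_commutator_le_right]
    refine le_trans (le_factorCentralizer_iff.1 ?_) le_sup_right
    refine sup_le (le_factorCentralizer_iff.2 ?_) (le_factorCentralizer_iff.2 ?_)
    · rwa [commutator_comm]
    · exact commutator_le_right _ _
  have hY : C ≤ (C ⊓ X) ⊔ N := by
    intro c hc
    obtain ⟨x, hx, n, hn, rfl⟩ := Subgroup.mem_sup_of_normal_right.1 (hCX hc)
    exact Subgroup.mul_mem_sup ⟨(Subgroup.mul_mem_cancel_right _ (hNC hn)).1 hc, hx⟩ hn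
  -- The index of C ∩ X in (C ∩ X) N divides |N|, and (C ∩ X) N contains `Q`. Hence some Sylow
  -- q-subgroup normalizes `P` and commutes with it modulo `N`, and N ∩ P = 1.
  have hidx : ¬ q ∣ (C ⊓ X).index := by
    rw [← Subgroup.relIndex_mul_index (le_sup_left : C ⊓ X ≤ (C ⊓ X) ⊔ N)]
    refine Nat.Prime.not_dvd_mul hq.out (fun hd => ?_) (fun hd => ?_)
    · have h1 := hd.trans (Subgroup.relIndex_sup_dvd_card (C ⊓ X) N)
      exact hq.out.coprime_iff_not_dvd.1 hNq.symm h1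
    · exact Q.not_dvd_index (hd.trans (Subgroup.index_dvd_of_le (hQC.trans hY)))
  obtain ⟨Q', hQ'⟩ := Sylow.exists_le_of_not_dvd_index hidx
  refine ⟨P, Q', ?_⟩
  have h1 : ⁅(P : Subgroup G), (Q' : Subgroup G)⁆ ≤ N :=
    (commutator_mono le_rfl (hQ'.trans inf_le_left)).trans hPC
  have h2 : ⁅(P : Subgroup G), (Q' : Subgroup G)⁆ ≤ P :=
    le_normalizer_iff_commutator_le_left.1 (hQ'.trans inf_le_right)
  refine (le_inf h1 h2).trans (le_of_eq ?_)
  refine (Subgroup.disjoint_of_coprime_natCard ?_).eq_bot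
  obtain ⟨k, hk⟩ := IsPGroup.iff_card.1 P.isPGroup'
  rw [hk]
  exact hNp.pow_right k

end SylowCommute

/-! ### Edges of the Sylow graph -/

section SylowEdge

variable {G : Type*} [Group G]

theorem normalizer_le_normalizer_centralizer (P : Subgroup G) :
    normalizer (P : Set G) ≤ normalizer (centralizer (P : Set G) : Set G) :=
  le_normalizer_of_normal_subgroupOf (centralizer_le_normalizer _)

instance mulCentralizer_subgroupOf_normal (P : Subgroup G) :
    ((mulCentralizer P).subgroupOf (normalizer (P : Set G))).Normal := by
  refine normal_subgroupOf_of_le_normalizer ?_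
  have h : normalizer (P : Set G) ≤ normalizer (centralizer (P : Set G) : Set G) :=
    normalizer_le_normalizer_centralizer P
  exact (le_inf le_rfl h).trans (normalizer_inf_normalizer_le_normalizer_sup _ _)

variable [Finite G] {p q : ℕ} [hp : Fact p.Prime] [hq : Fact q.Prime]

/-- Since q does not divide |N_G(P) : P C_G(P)|, x = ac with a in P and c in C_G(P). A p-power of x
is then a power of c, a q-power of x is 1, and the exponents are coprime. -/
theorem mem_centralizer_of_not_sylowEdge (hpq : p ≠ q) (h : ¬ SylowEdge G p q) (P : Sylow p G)
    {x : G} {k : ℕ} (hx : x ^ q ^ k = 1) (hxN : x ∈ normalizer ((P : Subgroup G) : Set G)) :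
    x ∈ centralizer ((P : Subgroup G) : Set G) := by
  have h1 : ¬ q ∣ ((mulCentralizer (P : Subgroup G)).subgroupOf
      (normalizer ((P : Subgroup G) : Set G))).index := fun hd => h ⟨P, hd⟩
  have h2 := Subgroup.mem_of_pow_eq_one_of_not_dvd_index hq.out h1
    (x := ⟨x, hxN⟩) (k := k) (by ext; simpa using hx)
  rw [Subgroup.mem_subgroupOf] at h2
  have h3 : x ∈ ((P : Subgroup G) : Set G) * (centralizer ((P : Subgroup G) : Set G) : Set G) := by
    rw [← Subgroup.coe_mul_of_left_le_normalizer_right _ _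
      (le_normalizer.trans (normalizer_le_normalizer_centralizer _))]
    exact h2
  obtain ⟨a, ha, c, hc, rfl⟩ := h3
  obtain ⟨m, hm⟩ := P.isPGroup'.exists_pow_eq_one ha
  have hac : Commute a c := Subgroup.mem_centralizer_iff.1 hc a ha
  refine Subgroup.mem_of_pow_mem_of_coprime (a := p ^ m) (b := q ^ k)
    (Nat.Coprime.pow _ _ ((Nat.coprime_primes hp.out hq.out).2 hpq)) ?_ ?_
  · simp only [hac.mul_pow, hm, one_mul]
    exact pow_mem hc _
  · exact hx ▸ one_mem _

omit hp in
theorem not_sylowEdge_of_forall_mem_centralizer 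
    (h : ∀ (P : Sylow p G) (x : G) (k : ℕ), x ^ q ^ k = 1 →
      x ∈ normalizer ((P : Subgroup G) : Set G) → x ∈ centralizer ((P : Subgroup G) : Set G)) :
    ¬ SylowEdge G p q := by
  rintro ⟨P, hd⟩
  obtain ⟨S⟩ := Sylow.nonempty (p := q) (G := normalizer ((P : Subgroup G) : Set G))
  refine S.not_dvd_index (hd.trans (Subgroup.index_dvd_of_le fun x hx => ?_))
  obtain ⟨k, hk⟩ := S.isPGroup'.exists_pow_eq_one hx
  rw [Subgroup.mem_subgroupOf]
  exact (le_sup_right : _ ≤ mulCentralizer (P : Subgroup G))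
    (h P x k (by simpa [Subtype.ext_iff] using hk) x.2)

omit hq in
-- By the Frattini argument the normalizer of f(P) is the image of N_G(P), while P C_G(P) maps into
-- f(P) C_H(f(P)); so the index downstairs divides the index upstairs.
theorem SylowEdge.of_surjective {H : Type*} [Group H] {f : G →* H} (hf : Function.Surjective f)
    (h : SylowEdge H p q) : SylowEdge G p q := by
  obtain ⟨P, hd⟩ := h
  obtain ⟨P, rfl⟩ := Sylow.mapSurjective_surjective hf p P
  refine ⟨P, hd.trans ?_⟩
  rw [Sylow.coe_mapSurjective]
  set X := normalizer ((P : Subgroup G) : Set G) with hX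
  have h1 : normalizer (((P : Subgroup G).map f : Subgroup H) : Set H) = X.map f := by
    refine le_antisymm ?_ (le_normalizer_map f)
    rw [← Subgroup.map_comap_eq_self_of_surjective hf (normalizer _),
      comap_normalizer_eq_of_surjective _ hf, Subgroup.comap_map_eq, Subgroup.map_le_iff_le_comap,
      Subgroup.comap_map_eq]
    exact P.normalizer_sup_le _
  have h2 : (mulCentralizer (P : Subgroup G)).map f ≤ mulCentralizer ((P : Subgroup G).map f) := by
    rw [mulCentralizer, Subgroup.map_sup]
    refine sup_le_sup_left ?_ _
    exact map_centralizer_le_centralizer_image _ _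
  rw [h1]
  refine (Subgroup.index_dvd_of_le ?_).trans
    (Subgroup.index_map_dvd (f := f.subgroupMap X)
      ((mulCentralizer (P : Subgroup G)).subgroupOf X) (f.subgroupMap_surjective X))
  rintro _ ⟨x, hx, rfl⟩
  exact h2 ⟨x, hx, rfl⟩

end SylowEdge

/-! ### Lifting commuting Sylow subgroups through normal subgroups -/

section Commute

variable {G : Type*} [Group G] [Finite G] {p q : ℕ} [hp : Fact p.Prime] [hq : Fact q.Prime]

theorem Subgroup.card_quotient_lt_of_ne_bot {N : Subgroup G} (h : N ≠ ⊥) :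
    Nat.card (G ⧸ N) < Nat.card G := by
  rw [Subgroup.card_eq_card_quotient_mul_card_subgroup N]
  refine lt_mul_of_one_lt_right Nat.card_pos ?_
  exact N.one_lt_card_iff_ne_bot.2 h

/-- A normal p-subgroup `N` lies in `P`, so `Q` normalizes `P`; the missing edge makes it centralize
`P`. -/
theorem SylowCommute.bot_of_not_sylowEdge (hpq : p ≠ q)
    (h : ¬ SylowEdge G p q) {N : Subgroup G} [N.Normal] (hN : IsPGroup p N)
    (hc : SylowCommute G p q N) : SylowCommute G p q ⊥ := by
  obtain ⟨P, Q, hc⟩ := hc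
  refine ⟨P, Q, le_of_eq ?_⟩
  rw [commutator_comm, commutator_eq_bot_iff_le_centralizer]
  intro x hx
  obtain ⟨k, hk⟩ := Q.isPGroup'.exists_pow_eq_one hx
  refine mem_centralizer_of_not_sylowEdge hpq h P hk ?_
  exact le_normalizer_iff_commutator_le_left.2 (hc.trans (hN.le_sylow_of_normal P)) hx

/-- A soluble group without edges between `p` and `q` in its Sylow graph has commuting Sylow
`p`- and `q`-subgroups. -/
theorem sylowCommute_of_not_sylowEdge (hpq : p ≠ q) (G : Type*) [Group G] [Finite G]
    [Group.IsSolvable G] (h1 : ¬ SylowEdge G p q) (h2 : ¬ SylowEdge G q p) :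
    SylowCommute G p q ⊥ := by
  induction hn : Nat.card G using Nat.strong_induction_on generalizing G with
  | _ n ih =>
  rcases subsingleton_or_nontrivial G with hs | hs
  · obtain ⟨P⟩ := Sylow.nonempty (p := p) (G := G)
    obtain ⟨Q⟩ := Sylow.nonempty (p := q) (G := G)
    exact ⟨P, Q, (Subsingleton.elim _ _ : _ = (⊥ : Subgroup G)).le⟩
  obtain ⟨r, hr, R, hR, hRr, hne⟩ := exists_characteristic_isPGroup_ne_bot G
  have hsurj := QuotientGroup.mk'_surjective R
  have hlt : Nat.card (G ⧸ R) < n := hn ▸ card_quotient_lt_of_ne_bot hne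
  have h3 : SylowCommute G p q R := (ih _ hlt (G ⧸ R) (fun h => h1 (h.of_surjective hsurj))
    (fun h => h2 (h.of_surjective hsurj)) rfl).of_quotient
  rcases eq_or_ne r p with rfl | hrp
  · exact h3.bot_of_not_sylowEdge hpq h1 hRr
  rcases eq_or_ne r q with rfl | hrq
  · exact (h3.symm.bot_of_not_sylowEdge hpq.symm h2 hRr).symm
  · exact h3.bot_of_coprime (hRr.coprime_card hrp) (hRr.coprime_card hrq)

/-- If `N` is a normal `p`-subgroup inside the Frattini subgroup and `P`, `Q` commute modulo `N`,
then `Q` centralizes `N`. -/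
theorem le_centralizer_of_le_frattini (hpq : p ≠ q) (G : Type*) [Group G] [Finite G]
    [Group.IsSolvable G] (N : Subgroup G) [N.Normal] (hN : IsPGroup p N) (hNF : N ≤ frattini G)
    (P : Sylow p G) (Q : Sylow q G) (h : ⁅(P : Subgroup G), (Q : Subgroup G)⁆ ≤ N) :
    ⁅N, (Q : Subgroup G)⁆ = ⊥ := by
  induction hn : Nat.card G using Nat.strong_induction_on generalizing G with
  | _ n ih =>
  set f := QuotientGroup.mk' N with hf
  have hsurj : Function.Surjective f := QuotientGroup.mk'_surjective N
  have hker : f.ker = N := QuotientGroup.ker_mk' N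
  -- Every normal p-subgroup of G/N lies in the image of `P`, so the image of `Q` centralizes it,
  -- and hence so does `B`.
  set B := normalClosure (((Q : Subgroup G).map f : Subgroup (G ⧸ N)) : Set (G ⧸ N)) with hB
  have hQB : (Q : Subgroup G).map f ≤ B := le_normalClosure
  have hcomm : ⁅(P : Subgroup G).map f, (Q : Subgroup G).map f⁆ = ⊥ := by
    rw [← map_commutator, Subgroup.map_eq_bot_iff, hker]
    exact h
  by_cases hBp : IsPGroup p B
  · have h1 : (Q : Subgroup G) ≤ N := by
      rw [← hker, ← Subgroup.map_eq_bot_iff]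
      have h2 := IsPGroup.disjoint_of_ne p q hpq _ _ (hBp.to_le hQB) (Q.isPGroup'.map f)
      exact disjoint_self.1 h2
    have h2 : (Q : Subgroup G) = ⊥ :=
      disjoint_self.1 (IsPGroup.disjoint_of_ne p q hpq _ _ (hN.to_le h1) Q.isPGroup')
    rw [h2, commutator_bot_right]
  have h1 : ∀ R : Subgroup B, R.Characteristic → IsPGroup p R → R ≤ center B := by
    intro R hR hRp
    have h2 : R.map B.subtype ≤ (P : Subgroup G).map f :=
      (hRp.map B.subtype).le_sylow_of_normal (P.mapSurjective hsurj)
    have h3 : (Q : Subgroup G).map f ≤ centralizer (R.map B.subtype : Subgroup (G ⧸ N)) := by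
      rw [← commutator_eq_bot_iff_le_centralizer, commutator_comm, eq_bot_iff, ← hcomm]
      exact commutator_mono h2 le_rfl
    have h4 : B ≤ centralizer (R.map B.subtype : Subgroup (G ⧸ N)) := normalClosure_le_normal h3
    intro x hx
    rw [mem_center_iff]
    intro b
    have := mem_centralizer_iff.1 (h4 b.2) x ⟨x, hx, rfl⟩
    exact Subtype.ext this.symm
  -- As the characteristic p-subgroups of `B` are central and `B` is not a p-group, some prime r ≠ p
  -- contributes a nontrivial characteristic r-subgroup.
  obtain ⟨r, hr, hrp, R, hR, hRr, hRne⟩ : ∃ r : ℕ, r.Prime ∧ r ≠ p ∧ ∃ R : Subgroup B,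
      R.Characteristic ∧ IsPGroup r R ∧ R ≠ ⊥ := by
    by_contra! hcon
    exact hBp (isPGroup_of_characteristic_isPGroup_central h1 hcon)
  have : Fact r.Prime := ⟨hr⟩
  set M := (R.map B.subtype).comap f with hM
  have hNM : N ≤ M := hker.symm.le.trans (Subgroup.ker_le_comap _ _)
  have hMne : M ≠ N := by
    intro h5
    apply hRne
    have h6 : R.map B.subtype = ⊥ := by
      rw [← Subgroup.map_comap_eq_self_of_surjective hsurj (R.map B.subtype), ← hM, h5,
        Subgroup.map_eq_bot_iff, hker]
    exact (Subgroup.map_eq_bot_iff_of_injective _ B.subtype_injective).1 h6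
  obtain ⟨S⟩ := Sylow.nonempty (p := r) (G := M)
  set T := (S : Subgroup M).map M.subtype with hT
  have hTr : IsPGroup r T := S.isPGroup'.map _
  have hMT : M ≤ T ⊔ N := by
    have h5 : (S : Subgroup M) ⊔ N.subgroupOf M = ⊤ := by
      rw [← Subgroup.index_eq_one]
      have h6 : N.relIndex M = Nat.card (R.map B.subtype) := by
        have h7 := relIndex_ker (K := M) f
        rwa [hker, hM, Subgroup.map_comap_eq_self_of_surjective hsurj] at h7
      obtain ⟨k, hk⟩ := IsPGroup.iff_card.1 (hRr.map B.subtype)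
      have h7 : ((S : Subgroup M) ⊔ N.subgroupOf M).index ∣ r ^ k := by
        rw [← hk, ← h6]
        exact Subgroup.index_dvd_of_le le_sup_right
      have h8 : ¬ r ∣ ((S : Subgroup M) ⊔ N.subgroupOf M).index := fun hd =>
        S.not_dvd_index (hd.trans (Subgroup.index_dvd_of_le le_sup_left))
      exact Nat.eq_one_of_dvd_coprimes ((hr.coprime_iff_not_dvd.2 h8).pow_left k) h7 dvd_rfl
    have h6 := congrArg (Subgroup.map M.subtype) h5
    rw [Subgroup.map_sup, Subgroup.map_subgroupOf_eq_of_le hNM, ← MonoidHom.range_eq_map,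
      Subgroup.range_subtype] at h6
    exact h6.ge
  have hTne : T ≠ ⊥ := by
    intro h5
    rw [h5, bot_sup_eq] at hMT
    exact hMne (le_antisymm hMT hNM)
  -- Frattini argument: G = N_G(T) M = N_G(T) N, and `N` consists of nongenerators.
  have hTn : T.Normal := by
    rw [← normalizer_eq_top_iff]
    apply frattini_nongenerating
    rw [eq_top_iff, ← S.normalizer_sup_eq_top]
    exact sup_le le_sup_left (hMT.trans (sup_le_sup le_normalizer hNF))
  have hlt : Nat.card (G ⧸ T) < n := hn ▸ card_quotient_lt_of_ne_bot hTne
  have hsurjT := QuotientGroup.mk'_surjective T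
  -- Induction in G/T gives [N, Q] ≤ T; but [N, Q] ≤ N and T ∩ N = 1.
  have h5 := ih _ hlt (G ⧸ T) (N.map (QuotientGroup.mk' T)) (hN.map _)
    ((Subgroup.map_mono hNF).trans (Subgroup.map_le_iff_le_comap.2
      (frattini_le_comap_frattini_of_surjective hsurjT)))
    (P.mapSurjective hsurjT) (Q.mapSurjective hsurjT) (by
      rw [Sylow.coe_mapSurjective, Sylow.coe_mapSurjective, ← map_commutator]
      exact Subgroup.map_mono h) rfl
  rw [Sylow.coe_mapSurjective, ← map_commutator, Subgroup.map_eq_bot_iff,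
    QuotientGroup.ker_mk'] at h5
  have h6 := IsPGroup.disjoint_of_ne r p hrp _ _ hTr hN
  exact eq_bot_iff.2 (h6 h5 (commutator_le_left _ _))

/-- `Q` centralizes `N`, so a q-element x takes y in `P` to yz with z in `N` commuting with x;
coprimality of orders forces z = 1. -/
theorem SylowCommute.bot_of_isPGroup_of_le_frattini [Group.IsSolvable G] (hpq : p ≠ q)
    {N : Subgroup G} [N.Normal] (hN : IsPGroup p N) (hNF : N ≤ frattini G)
    (h : SylowCommute G p q N) : SylowCommute G p q ⊥ := by
  obtain ⟨P, Q, h⟩ := h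
  have h1 := le_centralizer_of_le_frattini hpq G N hN hNF P Q h
  refine ⟨P, Q, ?_⟩
  rw [Subgroup.commutator_le] at h ⊢
  intro y hy x hx
  obtain ⟨k, hk⟩ := Q.isPGroup'.exists_pow_eq_one hx
  have hz : ⁅y⁻¹, x⁆ ∈ N := h _ (inv_mem hy) x hx
  obtain ⟨m, hm⟩ := hN.exists_pow_eq_one hz
  have hxz : Commute x ⁅y⁻¹, x⁆ := by
    have := commutator_mem_commutator hz hx
    rw [h1, mem_bot] at this
    exact (commutatorElement_eq_one_iff_commute.1 this).symm
  have := commute_of_conj_eq_mul (y := y) (z := ⁅y⁻¹, x⁆) (a := q ^ k) (b := p ^ m)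
    (Nat.Coprime.pow _ _ ((Nat.coprime_primes hq.out hp.out).2 hpq.symm)) hk hm hxz
    (by rw [commutatorElement_def]; group)
  rw [mem_bot, commutatorElement_eq_one_iff_commute]
  exact this.symm

/-- Sylow subgroups commuting modulo a normal subgroup `N` of the Frattini subgroup can be
replaced by commuting ones. -/
theorem SylowCommute.bot_of_le_frattini (hpq : p ≠ q) (G : Type*) [Group G] [Finite G]
    [Group.IsSolvable G] (N : Subgroup G) [N.Normal] (hNF : N ≤ frattini G)
    (h : SylowCommute G p q N) : SylowCommute G p q ⊥ := by
  induction hn : Nat.card G using Nat.strong_induction_on generalizing G with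
  | _ n ih =>
  rcases N.bot_or_nontrivial with rfl | hs
  · exact h
  obtain ⟨r, hr, R, hR, hRr, hne⟩ := exists_characteristic_isPGroup_ne_bot N
  have hK : (R.map N.subtype).Normal := inferInstance
  set K := R.map N.subtype with hKdef
  have hKN : K ≤ N := N.map_subtype_le R
  have hKr : IsPGroup r K := hRr.map _
  have hKne : K ≠ ⊥ := fun h5 =>
    hne ((Subgroup.map_eq_bot_iff_of_injective _ N.subtype_injective).1 h5)
  have hsurj := QuotientGroup.mk'_surjective K
  have hlt : Nat.card (G ⧸ K) < n := hn ▸ card_quotient_lt_of_ne_bot hKne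
  have h3 : SylowCommute G p q K := (ih _ hlt (G ⧸ K) (N.map (QuotientGroup.mk' K))
    ((Subgroup.map_mono hNF).trans (Subgroup.map_le_iff_le_comap.2
      (frattini_le_comap_frattini_of_surjective hsurj))) (h.map hsurj) rfl).of_quotient
  rcases eq_or_ne r p with rfl | hrp
  · exact h3.bot_of_isPGroup_of_le_frattini hpq hKr (hKN.trans hNF)
  rcases eq_or_ne r q with rfl | hrq
  · exact (h3.symm.bot_of_isPGroup_of_le_frattini hpq.symm hKr (hKN.trans hNF)).symm
  · exact h3.bot_of_coprime (hKr.coprime_card hrp) (hKr.coprime_card hrq)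

/-- A prime dividing the order of a finite group divides the index of its Frattini subgroup. -/
theorem dvd_index_frattini (G : Type*) [Group G] [Finite G] (h : p ∣ Nat.card G) :
    p ∣ (frattini G).index := by
  by_contra hd
  obtain ⟨P⟩ := Sylow.nonempty (p := p) (G := G)
  have hP : (P : Subgroup G) ≤ frattini G := fun x hx => by
    obtain ⟨k, hk⟩ := P.isPGroup'.exists_pow_eq_one hx
    exact Subgroup.mem_of_pow_eq_one_of_not_dvd_index hp.out hd hk
  have hn : (P : Subgroup G).Normal :=
    normalizer_eq_top_iff.1 (frattini_nongenerating (P.normalizer_sup_eq_top' hP))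
  -- A Schur–Zassenhaus complement of `P` generates G together with `P` ≤ Φ(G), so it is all of G
  -- and `P` is trivial.
  obtain ⟨M, hM⟩ := exists_right_complement'_of_coprime P.card_coprime_index
  have hMtop : M = ⊤ := by
    apply frattini_nongenerating
    rw [eq_top_iff, ← hM.sup_eq_top, sup_comm]
    exact sup_le_sup_left hP _
  have h1 := hM.disjoint
  rw [hMtop, disjoint_top] at h1
  exact P.ne_bot_of_dvd_card h h1

end Commute

/-! ### Action on chief factors -/

section ChiefFactor

variable {G : Type*} [Group G] [Finite G]

/-- Induction along a chief series. -/
theorem chiefFactor_induction {C : Subgroup G → Prop} (bot : C ⊥)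
    (step : ∀ (H K : Subgroup G) [H.Normal] [K.Normal], IsChiefFactor H K → C K → C H)
    (H : Subgroup G) [H.Normal] : C H := by
  induction hn : Nat.card H using Nat.strong_induction_on generalizing H with
  | _ n ih =>
  rcases eq_or_ne H ⊥ with rfl | hne
  · exact bot
  obtain ⟨K, hK⟩ := (Set.toFinite {K : Subgroup G | K.Normal ∧ K < H}).exists_maximal
    ⟨⊥, inferInstance, bot_lt_iff_ne_bot.2 hne⟩
  have hKn : K.Normal := hK.prop.1
  have hchief : IsChiefFactor H K :=
    { normal_top := inferInstance
      normal_bot := hKn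
      lt := hK.prop.2
      minimal := fun N hN hKN hNH => by
        rcases eq_or_lt_of_le hNH with h | h
        · exact Or.inr h
        · exact Or.inl (le_antisymm (hK.le_of_ge ⟨hN, h⟩ hKN) hKN) }
  refine step H K hchief (ih _ ?_ K rfl)
  rw [← hn]
  exact Set.ncard_lt_ncard (SetLike.coe_ssubset_coe.2 hK.prop.2) (Set.toFinite _)

variable {p q : ℕ} [hp : Fact p.Prime] [hq : Fact q.Prime]

/-- A chief factor of a soluble group whose order is divisible by `p` is a `p`-group. -/
theorem IsChiefFactor.isPGroup_map [Group.IsSolvable G] {H K : Subgroup G} [H.Normal] [K.Normal]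
    (h : IsChiefFactor H K) (hd : p ∣ K.relIndex H) :
    IsPGroup p (H.map (QuotientGroup.mk' K)) := by
  have hsurj := QuotientGroup.mk'_surjective K
  have hker : (QuotientGroup.mk' K).ker = K := QuotientGroup.ker_mk' K
  have hcard : K.relIndex H = Nat.card (H.map (QuotientGroup.mk' K)) := by
    have := relIndex_ker (K := H) (QuotientGroup.mk' K)
    rwa [hker] at this
  have hn : (H.map (QuotientGroup.mk' K)).Normal := Subgroup.Normal.map ‹_› _ hsurj
  rcases (H.map (QuotientGroup.mk' K)).bot_or_nontrivial with hb | hnt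
  · rw [hb]
    exact IsPGroup.of_bot
  obtain ⟨r, hr, R, hR, hRr, hne⟩ :=
    exists_characteristic_isPGroup_ne_bot (H.map (QuotientGroup.mk' K))
  have hRn : (R.map (H.map (QuotientGroup.mk' K)).subtype).Normal := inferInstance
  set T := R.map (H.map (QuotientGroup.mk' K)).subtype with hT
  have hTr : IsPGroup r T := hRr.map _
  have hTH : T ≤ H.map (QuotientGroup.mk' K) := (H.map (QuotientGroup.mk' K)).map_subtype_le R
  have hTm : (T.comap (QuotientGroup.mk' K)).map (QuotientGroup.mk' K) = T :=
    Subgroup.map_comap_eq_self_of_surjective hsurj T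
  have hTne : T ≠ ⊥ := fun h5 =>
    hne ((Subgroup.map_eq_bot_iff_of_injective _ (Subgroup.subtype_injective _)).1 h5)
  -- `T` is normal in G/K and nontrivial, so minimality forces T = H/K, and then r = p.
  rcases h.minimal (T.comap (QuotientGroup.mk' K)) (hRn.comap _)
    (hker.symm.le.trans (Subgroup.ker_le_comap _ _)) (by
      refine (Subgroup.comap_mono hTH).trans ?_
      rw [Subgroup.comap_map_eq, hker]
      exact sup_le le_rfl h.lt.le) with h1 | h1
  · exfalso
    apply hTne
    rw [← hTm, h1, QuotientGroup.map_mk'_self]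
  · rw [h1] at hTm
    rw [hTm]
    obtain ⟨k, hk⟩ := IsPGroup.iff_card.1 hTr
    rw [hcard, hTm, hk] at hd
    rwa [(Nat.prime_dvd_prime_iff_eq hp.out hr.out).1 (hp.out.dvd_of_dvd_pow hd)]

theorem SylowCommute.not_dvd_index_factorCentralizer [Group.IsSolvable G]
    (hc : SylowCommute G p q ⊥) {H K : Subgroup G} [H.Normal] [K.Normal]
    (h : IsChiefFactor H K) (hd : p ∣ K.relIndex H) : ¬ q ∣ (factorCentralizer H K).index := by
  obtain ⟨P, Q, hc⟩ := hc
  have hsurj := QuotientGroup.mk'_surjective K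
  have hHn : (H.map (QuotientGroup.mk' K)).Normal := Subgroup.Normal.map ‹_› _ hsurj
  have hHP : H ≤ (P : Subgroup G) ⊔ K := by
    have := (h.isPGroup_map hd).le_sylow_of_normal (P.mapSurjective hsurj)
    rwa [Sylow.coe_mapSurjective, Subgroup.map_le_iff_le_comap, Subgroup.comap_map_eq,
      QuotientGroup.ker_mk'] at this
  have hQ : (Q : Subgroup G) ≤ factorCentralizer H K := by
    rw [le_factorCentralizer_iff, commutator_comm]
    refine le_factorCentralizer_iff.1 (hHP.trans (sup_le ?_ ?_))
    · rw [le_factorCentralizer_iff, commutator_comm]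
      exact hc.trans bot_le
    · exact le_factorCentralizer_iff.2 (commutator_le_right _ _)
  exact fun h' => Q.not_dvd_index (h'.trans (Subgroup.index_dvd_of_le hQ))

/-- Climb a chief series, showing that x centralizes P ∩ H. If p divides |H/K|, x acts trivially on
H/K, so commutators with x fall into P ∩ K and coprime action applies; otherwise P ∩ H = P ∩ K. -/
theorem mem_centralizer_of_not_dvd_index_factorCentralizer (hpq : p ≠ q)
    (h : ∀ (H K : Subgroup G) [H.Normal] [K.Normal], IsChiefFactor H K → p ∣ K.relIndex H →
      ¬ q ∣ (factorCentralizer H K).index)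
    {P : Subgroup G} (hP : IsPGroup p P) {x : G} {k : ℕ} (hx : x ^ q ^ k = 1)
    (hxP : x ∈ normalizer (P : Set G)) : x ∈ centralizer (P : Set G) := by
  suffices hC : ∀ y ∈ P, y ∈ (⊤ : Subgroup G) → Commute x y from
    Subgroup.mem_centralizer_iff.2 fun y hy => (hC y hy (mem_top y)).eq.symm
  refine chiefFactor_induction (C := fun H => ∀ y ∈ P, y ∈ H → Commute x y) ?_ ?_ ⊤
  · intro y _ hy
    rw [mem_bot.1 hy]
    exact Commute.one_right x
  · intro H K _ _ hHK ih y hyP hyH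
    by_cases hd : p ∣ K.relIndex H
    · have hxC := Subgroup.mem_of_pow_eq_one_of_not_dvd_index hq.out (h H K hHK hd) hx
      have hzK := mem_factorCentralizer_iff_commutator.1 hxC _ (inv_mem hyH)
      have hzP : ⁅y⁻¹, x⁆ ∈ P := by
        have : ⁅y⁻¹, x⁆ = y⁻¹ * (x * y * x⁻¹) := by rw [commutatorElement_def]; group
        rw [this]
        exact mul_mem (inv_mem hyP) ((Subgroup.mem_normalizer_iff.1 hxP y).1 hyP)
      obtain ⟨m, hm⟩ := hP.exists_pow_eq_one hzP
      exact commute_of_conj_eq_mul (z := ⁅y⁻¹, x⁆) (a := q ^ k) (b := p ^ m)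
        (Nat.Coprime.pow _ _ ((Nat.coprime_primes hq.out hp.out).2 hpq.symm)) hx hm
        (ih _ hzP hzK) (by rw [commutatorElement_def]; group)
    · obtain ⟨m, hm⟩ := hP.exists_pow_eq_one hyP
      have := Subgroup.mem_of_pow_eq_one_of_not_dvd_index hp.out (H := K.subgroupOf H) hd
        (x := ⟨y, hyH⟩) (k := m) (by ext; simpa using hm)
      exact ih y hyP this

/-- In a group in which `q`-elements centralize the chief factors of order divisible by `p`, no
subgroup has the edge `(p, q)` in its Sylow graph. -/
theorem not_sylowEdge_subgroup (hpq : p ≠ q)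
    (h : ∀ (H K : Subgroup G) [H.Normal] [K.Normal], IsChiefFactor H K → p ∣ K.relIndex H →
      ¬ q ∣ (factorCentralizer H K).index) (L : Subgroup G) : ¬ SylowEdge L p q := by
  refine not_sylowEdge_of_forall_mem_centralizer fun P x k hx hxN => ?_
  have h1 := mem_centralizer_of_not_dvd_index_factorCentralizer hpq h (P.isPGroup'.map L.subtype)
    (x := x) (k := k) (by simpa [Subtype.ext_iff] using hx)
    (le_normalizer_map L.subtype ⟨x, hxN, rfl⟩)
  rw [Subgroup.mem_centralizer_iff] at h1 ⊢
  exact fun y hy => Subtype.ext (h1 y ⟨y, hy, rfl⟩)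

theorem not_sylowEdge_of_chiefFactor (hpq : p ≠ q)
    (h : ∀ (H K : Subgroup G) [H.Normal] [K.Normal], IsChiefFactor H K → p ∣ K.relIndex H →
      ¬ q ∣ (factorCentralizer H K).index) : ¬ SylowEdge G p q := by
  refine not_sylowEdge_of_forall_mem_centralizer fun P x k hx hxN => ?_
  exact mem_centralizer_of_not_dvd_index_factorCentralizer hpq h P.isPGroup' hx hxN

omit hq in
theorem not_sylowEdge_self : ¬ SylowEdge G p p := by
  rintro ⟨P, hd⟩
  exact P.not_dvd_index (hd.trans ((Subgroup.relIndex_dvd_of_le_left _ le_sup_left).trans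
    (Subgroup.relIndex_dvd_index_of_le le_normalizer)))

/-- With J = H ∩ C_G(H/K), J/K is abelian and H/J embeds in G/C_G(H/K), so solubility climbs a chief
series. -/
theorem isSolvable_of_chiefFactor
    (h : ∀ (H K : Subgroup G) [H.Normal] [K.Normal], IsChiefFactor H K →
      Group.IsSolvable (G ⧸ factorCentralizer H K)) : Group.IsSolvable G := by
  suffices hC : Group.IsSolvable (⊤ : Subgroup G) from
    Group.isSolvable_of_surjective (f := (Subgroup.topEquiv (G := G)).toMonoidHom)
      Subgroup.topEquiv.surjective
  refine chiefFactor_induction (C := fun H => Group.IsSolvable H) inferInstance ?_ ⊤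
  intro H K _ _ hHK hK
  have := h H K hHK
  set J := H ⊓ factorCentralizer H K with hJ
  have hKJ : K ≤ J := le_inf hHK.lt.le (le_factorCentralizer_iff.2 (commutator_le_right _ _))
  have hJs : Group.IsSolvable J := by
    let g := (QuotientGroup.mk' K).comp J.subtype
    have hg : Group.IsSolvable g.range := by
      refine Group.isSolvable_of_comm ?_
      rintro ⟨_, a, rfl⟩ ⟨_, b, rfl⟩
      refine Subtype.ext (commutatorElement_eq_one_iff_mul_comm.1 ?_)
      change ⁅g a, g b⁆ = 1
      rw [← map_commutatorElement]
      exact (QuotientGroup.eq_one_iff _).2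
        (mem_factorCentralizer_iff_commutator.1 b.2.2 a a.2.1)
    refine Group.isSolvable_of_ker_le_range (Subgroup.inclusion hKJ) g.rangeRestrict ?_
    rw [MonoidHom.ker_rangeRestrict]
    intro x hx
    exact ⟨⟨x, (QuotientGroup.eq_one_iff (x : G)).1 hx⟩, rfl⟩
  refine Group.isSolvable_of_ker_le_range (Subgroup.inclusion (inf_le_left : J ≤ H))
    ((QuotientGroup.mk' (factorCentralizer H K)).comp H.subtype) ?_
  intro x hx
  exact ⟨⟨x, x.2, (QuotientGroup.eq_one_iff (x : G)).1 hx⟩, rfl⟩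

end ChiefFactor

/-! ### Subdirect products -/

section SubdirectProduct

variable {G : Type*} [Group G]

theorem isSolvable_of_iInf_eq_bot {ι : Type*} [Finite ι] (N : ι → Subgroup G) [∀ i, (N i).Normal]
    (hN : ⨅ i, N i = ⊥) (h : ∀ i, Group.IsSolvable (G ⧸ N i)) : Group.IsSolvable G := by
  have h1 : ∀ i, ∃ n, derivedSeries (G ⧸ N i) n = ⊥ := fun i => (h i).solvable
  choose n hn using h1
  obtain ⟨m, hm⟩ := (Set.finite_range n).bddAbove
  refine ⟨⟨m, ?_⟩⟩
  rw [eq_bot_iff, ← hN]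
  refine le_iInf fun i => ?_
  have h2 := map_derivedSeries_le_derivedSeries (QuotientGroup.mk' (N i)) (n i)
  rw [hn i, le_bot_iff, Subgroup.map_eq_bot_iff, QuotientGroup.ker_mk'] at h2
  exact (derivedSeries_antitone G (hm ⟨i, rfl⟩)).trans h2

variable [Finite G]

theorem exists_mem_primesOf_quotient {ι : Type*} (N : ι → Subgroup G) [∀ i, (N i).Normal]
    (hN : ⨅ i, N i = ⊥) {p : ℕ} (hp : p ∈ primesOf G) : ∃ i, p ∈ primesOf (G ⧸ N i) := by
  by_contra! hcon
  have hp' := Nat.prime_of_mem_primeFactors hp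
  have : Fact p.Prime := ⟨hp'⟩
  obtain ⟨P⟩ := Sylow.nonempty (p := p) (G := G)
  refine P.ne_bot_of_dvd_card (Nat.dvd_of_mem_primeFactors hp) ?_
  rw [eq_bot_iff, ← hN]
  refine le_iInf fun i x hx => ?_
  obtain ⟨k, hk⟩ := P.isPGroup'.exists_pow_eq_one hx
  refine Subgroup.mem_of_pow_eq_one_of_not_dvd_index hp' (fun hd => hcon i ?_) hk
  exact Nat.mem_primeFactors.2 ⟨hp', (index_eq_card (N i)) ▸ hd, Nat.card_pos.ne'⟩

/-- A q-element normalizing `P` centralizes its image in each quotient, so its commutators with `P`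
lie in every `N i`. -/
theorem not_sylowEdge_of_iInf_eq_bot {p q : ℕ} [hp : Fact p.Prime] [hq : Fact q.Prime]
    (hpq : p ≠ q) {ι : Type*} (N : ι → Subgroup G) [∀ i, (N i).Normal]
    (hN : ⨅ i, N i = ⊥) (h : ∀ i, ¬ SylowEdge (G ⧸ N i) p q) : ¬ SylowEdge G p q := by
  refine not_sylowEdge_of_forall_mem_centralizer fun P x k hx hxN => ?_
  rw [Subgroup.mem_centralizer_iff]
  intro y hy
  rw [← commutatorElement_eq_one_iff_mul_comm, ← mem_bot, ← hN, mem_iInf]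
  intro i
  have hsurj := QuotientGroup.mk'_surjective (N i)
  have h1 := mem_centralizer_of_not_sylowEdge hpq (h i) (P.mapSurjective hsurj)
    (x := QuotientGroup.mk' (N i) x) (k := k) (by rw [← map_pow, hx, map_one])
    (le_normalizer_map _ ⟨x, hxN, rfl⟩)
  rw [Subgroup.mem_centralizer_iff] at h1
  have h2 := h1 (QuotientGroup.mk' (N i) y) ⟨y, hy, rfl⟩
  rw [← commutatorElement_eq_one_iff_mul_comm, ← map_commutatorElement] at h2
  exact (QuotientGroup.eq_one_iff _).1 h2

end SubdirectProduct

/-! ### Classes of groups and graph membership -/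

namespace GroupClass

theorem ext_mem {𝔛 𝔜 : GroupClass.{u}} (h : ∀ (G : Type u) [Group G], 𝔛.Mem G ↔ 𝔜.Mem G) :
    𝔛 = 𝔜 := by
  cases 𝔛
  cases 𝔜
  congr
  funext G _
  exact propext (h G)

theorem solublePi_isFormation (π : Set ℕ) : (solublePi.{u} π).IsFormation := by
  constructor
  · rintro G H _ _ f hf ⟨⟨hfin, hsol⟩, hπ⟩
    have hH : Finite H := Finite.of_surjective f hf
    exact ⟨⟨hH, Group.isSolvable_of_surjective hf⟩,
      (primesOf_subset_of_dvd (card_dvd_of_surjective f hf)).trans hπ⟩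
  · intro G _ _ n N _ hN hbot
    refine ⟨⟨inferInstance, isSolvable_of_iInf_eq_bot N hbot fun i => (hN i).1.2⟩, fun p hp => ?_⟩
    obtain ⟨i, hi⟩ := exists_mem_primesOf_quotient N hbot hp
    exact (hN i).2 hi

theorem empty_isFormation : empty.{u}.IsFormation :=
  ⟨fun _ _ _ _ _ _ h => h, fun _ _ _ _ _ _ h _ => h 0⟩

theorem primes_empty : empty.{u}.primes = ∅ :=
  Set.eq_empty_of_forall_notMem fun _ ⟨_, _, h, _⟩ => h

theorem exists_commGroup_primesOf_eq {p : ℕ} (hp : p.Prime) :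
    ∃ (G : Type u) (_ : CommGroup G), Finite G ∧ primesOf G = {p} := by
  have : NeZero p := ⟨hp.ne_zero⟩
  refine ⟨ULift.{u} (Multiplicative (ZMod p)), inferInstance, inferInstance, ?_⟩
  ext q
  simp [primesOf, hp.primeFactors]

theorem primes_solublePi {π : Set ℕ} (hπ : ∀ p ∈ π, p.Prime) : (solublePi.{u} π).primes = π := by
  ext p
  constructor
  · rintro ⟨G, _, hG, hp⟩
    exact hG.2 hp
  · intro hp
    obtain ⟨G, _, hfin, hG⟩ := exists_commGroup_primesOf_eq.{u} (hπ p hp)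
    exact ⟨G, inferInstance, ⟨⟨hfin, inferInstance⟩, by simpa [hG] using hp⟩, by simp [hG]⟩

theorem prime_of_mem_sylowGraph {𝔛 : GroupClass.{u}} {p : ℕ} (h : p ∈ 𝔛.sylowGraph.V) :
    p.Prime := by
  obtain ⟨G, _, _, _, hp⟩ := h
  exact Nat.prime_of_mem_primeFactors hp

end GroupClass

theorem sylowEdge_of_mem_sylowGraph {G : Type*} [Group G] [Finite G] {p q : ℕ}
    (h : (p, q) ∈ (sylowGraph G).E) : SylowEdge G p q := by
  obtain ⟨-, P, hP⟩ := h
  exact ⟨P, Nat.dvd_of_mem_primeFactors hP⟩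

theorem mem_sylowGraph_of_sylowEdge {G : Type*} [Group G] [Finite G] {p q : ℕ} [hp : Fact p.Prime]
    [hq : Fact q.Prime] (h : SylowEdge G p q) : (p, q) ∈ (sylowGraph G).E := by
  obtain ⟨P, hP⟩ := h
  refine ⟨Nat.mem_primeFactors.2 ⟨hp.out, ?_, Nat.card_pos.ne'⟩, P,
    Nat.mem_primeFactors.2 ⟨hq.out, hP, Nat.card_pos.ne'⟩⟩
  -- If p does not divide |G|, then `P` is trivial, P C_G(P) = G, and the index is 1.
  by_contra hd
  obtain ⟨k, hk⟩ := IsPGroup.iff_card.1 P.isPGroup'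
  have hk0 : k = 0 := by
    by_contra hk0
    exact hd (((dvd_pow_self p hk0).trans hk.symm.dvd).trans (Subgroup.card_subgroup_dvd_card _))
  rw [hk0, pow_zero, Subgroup.card_eq_one] at hk
  have htop : mulCentralizer (P : Subgroup G) = ⊤ := by
    rw [mulCentralizer, hk, bot_sup_eq, eq_top_iff]
    intro x _
    rw [Subgroup.mem_centralizer_iff]
    rintro y hy
    rw [Subgroup.mem_bot.1 hy, one_mul, mul_one]
  rw [htop, relIndex_top_left] at hP
  exact hq.out.one_lt.ne' (Nat.dvd_one.1 hP)

/-! ### Closure properties and the local definition -/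

namespace GroupClass

variable {𝔛 : GroupClass.{u}} {G : Type u} [Group G]

theorem mem_sylowClosure_inter_soluble_of [Finite G] (hs : Group.IsSolvable G)
    (hV : primesOf G ⊆ 𝔛.sylowGraph.V)
    (hE : ∀ (p q : ℕ) [Fact p.Prime] [Fact q.Prime], p ≠ q → (p, q) ∉ 𝔛.sylowGraph.E →
      ¬ SylowEdge G p q) : (𝔛.sylowClosure.inter soluble).Mem G := by
  refine ⟨⟨‹_›, hV, ?_⟩, ‹_›, hs⟩
  rintro ⟨p, q⟩ hpq
  have : Fact p.Prime := ⟨Nat.prime_of_mem_primeFactors ((_root_.sylowGraph G).left_mem _ hpq)⟩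
  have : Fact q.Prime := ⟨Nat.prime_of_mem_primeFactors ((_root_.sylowGraph G).right_mem _ hpq)⟩
  have hedge := sylowEdge_of_mem_sylowGraph hpq
  by_contra hnot
  refine hE p q ?_ hnot hedge
  rintro rfl
  exact not_sylowEdge_self hedge

theorem primesOf_subset_of_mem (h : (𝔛.sylowClosure.inter soluble).Mem G) :
    primesOf G ⊆ 𝔛.sylowGraph.V := by
  obtain ⟨⟨_, h, _⟩, _⟩ := h
  exact h

variable {p q : ℕ} [hp : Fact p.Prime] [hq : Fact q.Prime]

theorem not_sylowEdge_of_mem (h : (𝔛.sylowClosure.inter soluble).Mem G)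
    (hE : (p, q) ∉ 𝔛.sylowGraph.E) : ¬ SylowEdge G p q := by
  obtain ⟨⟨_, _, h⟩, _⟩ := h
  exact fun hedge => hE (h (mem_sylowGraph_of_sylowEdge hedge))

/-- Undirectedness supplies the second missing edge (q, p). -/
theorem sylowCommute_of_mem (h𝔛 : 𝔛.sylowGraph.IsUndirected)
    (h : (𝔛.sylowClosure.inter soluble).Mem G) (hpq : p ≠ q) (hE : (p, q) ∉ 𝔛.sylowGraph.E) :
    SylowCommute G p q ⊥ := by
  obtain ⟨hfin, hs⟩ := h.2
  exact sylowCommute_of_not_sylowEdge hpq G (not_sylowEdge_of_mem h hE)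
    (not_sylowEdge_of_mem h ((h𝔛 p q).not.1 hE))

omit hp hq in
theorem mem_of_sylowCommute [Finite G] (hs : Group.IsSolvable G)
    (hV : primesOf G ⊆ 𝔛.sylowGraph.V)
    (hE : ∀ (p q : ℕ) [Fact p.Prime] [Fact q.Prime], p ≠ q → (p, q) ∉ 𝔛.sylowGraph.E →
      SylowCommute G p q ⊥) : (𝔛.sylowClosure.inter soluble).Mem G :=
  mem_sylowClosure_inter_soluble_of hs hV fun p q _ _ hpq hnot =>
    not_sylowEdge_of_chiefFactor hpq fun _ _ _ _ h hd =>
      (hE p q hpq hnot).not_dvd_index_factorCentralizer h hd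

omit hp hq

theorem sylowClosure_inter_soluble_isFormation (h𝔛 : 𝔛.sylowGraph.IsUndirected) :
    (𝔛.sylowClosure.inter soluble).IsFormation := by
  constructor
  · intro G H _ _ f hf h
    obtain ⟨hfin, hs⟩ := h.2
    have hH : Finite H := Finite.of_surjective f hf
    refine mem_of_sylowCommute (Group.isSolvable_of_surjective hf)
      ((primesOf_subset_of_dvd (card_dvd_of_surjective f hf)).trans (primesOf_subset_of_mem h))
      fun p q _ _ hpq hE => ?_
    simpa using (sylowCommute_of_mem h𝔛 h hpq hE).map hf
  · intro G _ _ n N _ hN hbot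
    refine mem_sylowClosure_inter_soluble_of
      (isSolvable_of_iInf_eq_bot N hbot fun i => (hN i).2.2) (fun p hp => ?_)
      fun p q _ _ hpq hE => not_sylowEdge_of_iInf_eq_bot hpq N hbot fun i =>
        not_sylowEdge_of_mem (hN i) hE
    obtain ⟨i, hi⟩ := exists_mem_primesOf_quotient N hbot hp
    exact primesOf_subset_of_mem (hN i) hi

/-- Sylow subgroups of H need not be Sylow in G, so the argument goes through the chief factors of
G, which control all its p-subgroups. -/
theorem sylowClosure_inter_soluble_isHereditary (h𝔛 : 𝔛.sylowGraph.IsUndirected) :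
    (𝔛.sylowClosure.inter soluble).IsHereditary := by
  intro G _ H h
  obtain ⟨hfin, hs⟩ := h.2
  refine mem_sylowClosure_inter_soluble_of inferInstance
    ((primesOf_subset_of_dvd (Subgroup.card_subgroup_dvd_card H)).trans (primesOf_subset_of_mem h))
    fun p q _ _ hpq hE => not_sylowEdge_subgroup hpq (fun _ _ _ _ hHK hd => ?_) H
  exact (sylowCommute_of_mem h𝔛 h hpq hE).not_dvd_index_factorCentralizer hHK hd

theorem sylowClosure_inter_soluble_isSaturated (h𝔛 : 𝔛.sylowGraph.IsUndirected) :
    (𝔛.sylowClosure.inter soluble).IsSaturated := by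
  intro G _ _ h
  have hnil : Group.IsNilpotent (frattini G) := frattini_nilpotent
  have hs : Group.IsSolvable G :=
    (Group.isSolvable_iff_subgroup_quotient (frattini G)).2 ⟨inferInstance, h.2.2⟩
  refine mem_of_sylowCommute hs (fun p hp => primesOf_subset_of_mem h ?_) fun p q _ _ hpq hE =>
    SylowCommute.bot_of_le_frattini hpq G (frattini G) le_rfl
      (sylowCommute_of_mem h𝔛 h hpq hE).of_quotient
  have hp' := Nat.prime_of_mem_primeFactors hp
  have : Fact p.Prime := ⟨hp'⟩
  refine Nat.mem_primeFactors.2 ⟨hp', ?_, Nat.card_pos.ne'⟩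
  rw [← index_eq_card]
  exact dvd_index_frattini G (Nat.dvd_of_mem_primeFactors hp)

open Classical in
/-- The formation function with value `𝔖_π` at each vertex `p` of a graph, where `π` consists of
`p` and its neighbours, and the empty class elsewhere. -/
noncomputable def neighbourFormation (Γ : PrimeGraph) (p : ℕ) : GroupClass.{u} :=
  if p ∈ Γ.V then solublePi {q | q = p ∨ (p, q) ∈ Γ.E} else empty

theorem neighbourFormation_of_mem {Γ : PrimeGraph} {p : ℕ} (h : p ∈ Γ.V) :
    neighbourFormation.{u} Γ p = solublePi {q | q = p ∨ (p, q) ∈ Γ.E} := if_pos h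

theorem neighbourFormation_of_notMem {Γ : PrimeGraph} {p : ℕ} (h : p ∉ Γ.V) :
    neighbourFormation.{u} Γ p = empty := if_neg h

theorem mem_of_mem_neighbourFormation {Γ : PrimeGraph} {p : ℕ}
    (h : (neighbourFormation Γ p).Mem G) : p ∈ Γ.V := by
  by_contra hp
  rw [neighbourFormation_of_notMem hp] at h
  exact h

theorem sylowClosure_inter_soluble_eq_localFormation (h𝔛 : 𝔛.sylowGraph.IsUndirected) :
    𝔛.sylowClosure.inter soluble = localFormation (neighbourFormation 𝔛.sylowGraph) := by
  refine ext_mem fun G _ => ⟨fun h => ?_, fun h => ?_⟩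
  · obtain ⟨hfin, hs⟩ := h.2
    refine ⟨hfin, fun H K _ _ hHK p hp => ?_⟩
    have hp' := Nat.prime_of_mem_primeFactors hp
    have : Fact p.Prime := ⟨hp'⟩
    have hd : p ∣ K.relIndex H := Nat.dvd_of_mem_primeFactors hp
    have hpV : p ∈ 𝔛.sylowGraph.V := primesOf_subset_of_mem h <| Nat.mem_primeFactors.2
      ⟨hp', (hd.trans (relIndex_dvd_card K H)).trans (Subgroup.card_subgroup_dvd_card H),
        Nat.card_pos.ne'⟩
    rw [neighbourFormation_of_mem hpV]
    refine ⟨⟨inferInstance, inferInstance⟩, fun q hq => ?_⟩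
    by_contra hnot
    rw [Set.mem_ofPred_eq, not_or] at hnot
    have : Fact q.Prime := ⟨Nat.prime_of_mem_primeFactors hq⟩
    refine (sylowCommute_of_mem h𝔛 h (Ne.symm hnot.1) hnot.2).not_dvd_index_factorCentralizer
      hHK hd ?_
    rw [index_eq_card]
    exact Nat.dvd_of_mem_primeFactors hq
  · obtain ⟨hfin, h⟩ := h
    have hmem : ∀ (H K : Subgroup G) [H.Normal] [K.Normal], IsChiefFactor H K → ∀ p, p.Prime →
        p ∣ K.relIndex H → p ∈ 𝔛.sylowGraph.V ∧
          (solublePi {q | q = p ∨ (p, q) ∈ 𝔛.sylowGraph.E}).Mem (G ⧸ factorCentralizer H K) := by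
      intro H K _ _ hHK p hp hd
      have h1 := h H K hHK p (Nat.mem_primeFactors.2 ⟨hp, hd, Nat.card_pos.ne'⟩)
      have hpV := mem_of_mem_neighbourFormation h1
      exact ⟨hpV, neighbourFormation_of_mem hpV ▸ h1⟩
    refine mem_sylowClosure_inter_soluble_of (isSolvable_of_chiefFactor fun H K _ _ hHK => ?_)
      (fun p hp => ?_) fun p q hp hq hpq hE =>
        not_sylowEdge_of_chiefFactor hpq fun H K _ _ hHK hd hd' => ?_
    · have hne : K.relIndex H ≠ 1 := fun h1 => hHK.lt.not_ge (relIndex_eq_one.1 h1)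
      obtain ⟨p, hp, hd⟩ := Nat.exists_prime_and_dvd hne
      exact (hmem H K hHK p hp hd).2.1.2
    · have hp' := Nat.prime_of_mem_primeFactors hp
      -- A prime dividing |G| divides the order of some chief factor, where F(p) is nonempty.
      refine chiefFactor_induction (C := fun H => p ∣ Nat.card H → p ∈ 𝔛.sylowGraph.V)
        (fun hd => ?_) (fun H K _ _ hHK ih hd => ?_) (⊤ : Subgroup G) ?_
      · rw [Subgroup.card_bot] at hd
        exact absurd (Nat.dvd_one.1 hd) hp'.ne_one
      · have hcard : Nat.card K * K.relIndex H = Nat.card H := by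
          rw [← relIndex_bot_left, ← relIndex_bot_left, relIndex_mul_relIndex _ _ _ bot_le hHK.lt.le]
        rw [← hcard] at hd
        exact (hp'.dvd_mul.1 hd).elim ih fun h1 => (hmem H K hHK p hp' h1).1
      · rw [Subgroup.card_top]
        exact Nat.dvd_of_mem_primeFactors hp
    · rw [index_eq_card] at hd'
      have h1 := (hmem H K hHK p hp.out hd).2.2
        (Nat.mem_primeFactors.2 ⟨hq.out, hd', Nat.card_pos.ne'⟩)
      exact h1.elim (fun h2 => hpq h2.symm) hE

theorem primes_neighbourFormation {p : ℕ} (hp : p ∈ 𝔛.sylowGraph.V) :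
    (neighbourFormation.{u} 𝔛.sylowGraph p).primes = {q | q = p ∨ (p, q) ∈ 𝔛.sylowGraph.E} := by
  rw [neighbourFormation_of_mem hp, primes_solublePi]
  rintro q (rfl | hq)
  · exact prime_of_mem_sylowGraph hp
  · exact prime_of_mem_sylowGraph (𝔛.sylowGraph.right_mem _ hq)

/-- Each vertex p is realized by a group of order p, which is abelian and so has no edges. -/
theorem primes_sylowClosure_inter_soluble :
    (𝔛.sylowClosure.inter soluble).primes = 𝔛.sylowGraph.V := by
  ext p
  constructor
  · rintro ⟨G, _, hG, hp⟩
    exact primesOf_subset_of_mem hG hp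
  · intro hp
    obtain ⟨G, _, hfin, hG⟩ := exists_commGroup_primesOf_eq.{u} (prime_of_mem_sylowGraph hp)
    refine ⟨G, inferInstance, mem_of_sylowCommute inferInstance (by simpa [hG] using hp)
      fun p q _ _ _ _ => ?_, by simp [hG]⟩
    obtain ⟨P⟩ := Sylow.nonempty (p := p) (G := G)
    obtain ⟨Q⟩ := Sylow.nonempty (p := q) (G := G)
    refine ⟨P, Q, Subgroup.commutator_le.2 fun x _ y _ => ?_⟩
    rw [mem_bot, commutatorElement_eq_one_iff_mul_comm, mul_comm]

theorem sylowClosure_inter_soluble_isCoveringFormation (h𝔛 : 𝔛.sylowGraph.IsUndirected) :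
    (𝔛.sylowClosure.inter soluble).IsCoveringFormation := by
  refine ⟨neighbourFormation 𝔛.sylowGraph, fun p _ => ?_,
    sylowClosure_inter_soluble_eq_localFormation h𝔛, fun p hp => ?_, fun p _ hp => ?_,
    fun p q _ _ hpq => ?_⟩
  · by_cases hp : p ∈ 𝔛.sylowGraph.V
    · rw [neighbourFormation_of_mem hp]
      exact solublePi_isFormation _
    · rw [neighbourFormation_of_notMem hp]
      exact empty_isFormation
  · rw [primes_sylowClosure_inter_soluble] at hp
    rw [primes_neighbourFormation hp]
    exact ⟨neighbourFormation_of_mem hp, Or.inl rfl⟩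
  · rw [primes_sylowClosure_inter_soluble] at hp
    exact neighbourFormation_of_notMem hp
  · by_cases hq : q ∈ 𝔛.sylowGraph.V
    · rw [primes_neighbourFormation hq] at hpq
      rcases hpq with rfl | hE
      · rw [primes_neighbourFormation hq]
        exact Or.inl rfl
      · rw [primes_neighbourFormation (𝔛.sylowGraph.right_mem _ hE)]
        exact Or.inr ((h𝔛 q p).1 hE)
    · rw [neighbourFormation_of_notMem hq, primes_empty] at hpq
      exact hpq.elim

end GroupClass

theorem theorem4p6 (𝔛 : GroupClass.{u}) (h𝔛 : 𝔛.sylowGraph.IsUndirected) :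
    (𝔛.sylowClosure.inter GroupClass.soluble).IsCoveringFormation ∧
    (𝔛.sylowClosure.inter GroupClass.soluble).IsFormation ∧
    (𝔛.sylowClosure.inter GroupClass.soluble).IsHereditary ∧
    (𝔛.sylowClosure.inter GroupClass.soluble).IsSaturated :=
  ⟨GroupClass.sylowClosure_inter_soluble_isCoveringFormation h𝔛,
    GroupClass.sylowClosure_inter_soluble_isFormation h𝔛,
    GroupClass.sylowClosure_inter_soluble_isHereditary h𝔛,
    GroupClass.sylowClosure_inter_soluble_isSaturated h𝔛⟩
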